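/- Let $K\le N\le M$, let $A\in\mathbb{R}^{M\times N}$ and $B\in\mathbb{R}^{K\times N}$ have maximum rank ($\operatorname{rank}A=N$, $\operatorname{rank}B=K$), let $d\in\mathbb{R}^M$, $\alpha>0$ and $\lambda>0$. Consider $$\min_{u\in\mathbb{R}^N,\;z\in\mathbb{R}^K}\ \|z\|_1+\tfrac{\alpha}{2}\|Au-d\|_2^2\quad\text{subject to } z=Bu. \tag{1}$$ Put $F=\begin{bmatrix}\sqrt\alpha A\\ \sqrt\lambda B\end{bmatrix}$, $v(z,b)=\begin{bmatrix}\sqrt\alpha\, d\\ \sqrt\lambda(z+b)\end{bmatrix}$, and let $\operatorname{shrink}\{y,\gamma\}$ have components $\operatorname{sgn}(y_i)\max(|y_i|-\gamma,0)$. The unlimited-memory Compressive Conjugate Directions (CCD) method, run in exact arithmetic and without a stopping test, starts from $u_0=0$, $z_0=b_0=0$, $v_0=v(z_0,b_0)$, $p_0=F^Tv_0$, $q_0=Fp_0$, $\delta_0=q_0^Tq_0$, and for $k=0,1,2,\dots$ computes $$\tau_i=\frac{q_i^Tv_k}{\delta_i}\ (0\le i\le k),\qquad u_{k+1}=\sum_{i=0}^k\tau_ip_i,\qquad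 z_{k+1}=\operatorname{shrink}\{Bu_{k+1}-b_k,1/\lambda\},\qquad b_{k+1}=b_k+z_{k+1}-Bu_{k+1},$$ $$v_{k+1}=v(z_{k+1},b_{k+1}),\qquad w_{k+1}=F^T\Big(v_{k+1}-\sum_{i=0}^k\tau_iq_i\Big),\qquad s_{k+1}=Fw_{k+1},\qquad \beta_i=-\frac{q_i^Ts_{k+1}}{\delta_i}\ (0\le i\le k),$$ $$p_{k+1}=\sum_{i=0}^k\beta_ip_i+w_{k+1},\qquad q_{k+1}=\sum_{i=0}^k\beta_iq_i+s_{k+1},\qquad \delta_{k+1}=q_{k+1}^Tq_{k+1},$$ where, whenever a computed $\delta_j$ ($j\ge0$) is $0$, one resets $\delta_j=1$, $p_j=0$, $q_j=0$. Then problem (1) has a unique solution $(u^*,z^*)$, $z^*=Bu^*$; there is a unique $\mu^*\in\mathbb{R}^K$ (the vector of Lagrange multipliers) such that $(u^*,z^*,\mu^*)$ is a saddle point of the Lagrangian $\|z\|_1+\frac\alpha2\|Au-d\|_2^2+\mu^T(z-Bu)$ (a minimum in $(u,z)$ and a maximum in $\mu$); and, with $b^*=\mu^*/\lambda$, $$u_k\to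 u^*,\qquad z_k\to z^*,\qquad b_k\to b^*\qquad(k\to\infty).$$ Moreover, there are $k_1$ and a subspace $S\subseteq\mathbb{R}^N$ such that $\operatorname{span}\{p_0,\dots,p_k\}=S$ for all $k\ge k_1$, and from iteration $k_1$ on the CCD method coincides with the Alternating Direction Method of Multipliers (ADMM) restricted to $S$: for all $k\ge k_1$, $u_{k+1}$ is the unique minimizer over $u\in S$ of $$\tfrac{\lambda}{2}\|z_k-Bu+b_k\|_2^2+\tfrac{\alpha}{2}\|Au-d\|_2^2,\tag{2}$$ while $z_{k+1}=\operatorname{shrink}\{Bu_{k+1}-b_k,1/\lambda\}$ and $b_{k+1}=b_k+z_{k+1}-Bu_{k+1}$. If $S$ is invariant under $F^TF$ (in particular if $S=\mathbb{R}^N$), then from iteration $k_1$ on the CCD method coincides with the exact ADMM: for all $k\ge k_1$, $u_{k+1}$ is the unique minimizer of (2) over all of $\mathbb{R}^N$. -/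

import Mathlib

open Filter Topology Matrix

noncomputable section

namespace CCD

/-- The `ℓ¹` norm `‖x‖₁`. -/
def l1Norm {n : ℕ} (x : Fin n → ℝ) : ℝ := ∑ i, |x i|

/-- The squared Euclidean norm `‖x‖₂²`. -/
def sqNorm {n : ℕ} (x : Fin n → ℝ) : ℝ := ∑ i, x i ^ 2

/-- The objective `‖z‖₁ + (α/2) ‖A u - d‖₂²`. -/
def objective {M N K : ℕ} (A : Matrix (Fin M) (Fin N) ℝ) (d : Fin M → ℝ) (α : ℝ)
    (u : Fin N → ℝ) (z : Fin K → ℝ) : ℝ :=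
  l1Norm z + α / 2 * sqNorm (A *ᵥ u - d)

/-- `(u, z)` solves: minimize `‖z‖₁ + (α/2) ‖A u - d‖₂²` subject to `z = B u`. -/
def IsSolution {M N K : ℕ} (A : Matrix (Fin M) (Fin N) ℝ) (B : Matrix (Fin K) (Fin N) ℝ)
    (d : Fin M → ℝ) (α : ℝ) (u : Fin N → ℝ) (z : Fin K → ℝ) : Prop :=
  z = B *ᵥ u ∧
    ∀ (u' : Fin N → ℝ) (z' : Fin K → ℝ), z' = B *ᵥ u' → objective A d α u z ≤ objective A d α u' z'

/-- The Lagrangian `‖z‖₁ + (α/2) ‖A u - d‖₂² + μᵀ (z - B u)`. -/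
def lagrangian {M N K : ℕ} (A : Matrix (Fin M) (Fin N) ℝ) (B : Matrix (Fin K) (Fin N) ℝ)
    (d : Fin M → ℝ) (α : ℝ) (u : Fin N → ℝ) (z μ : Fin K → ℝ) : ℝ :=
  objective A d α u z + μ ⬝ᵥ (z - B *ᵥ u)

/-- `μ` is a vector of Lagrange multipliers for the constraint `z = B u` at `(u, z)`:
`(u, z, μ)` is a saddle point of the Lagrangian. -/
def IsLagrangeMultiplier {M N K : ℕ} (A : Matrix (Fin M) (Fin N) ℝ)
    (B : Matrix (Fin K) (Fin N) ℝ) (d : Fin M → ℝ) (α : ℝ)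
    (u : Fin N → ℝ) (z μ : Fin K → ℝ) : Prop :=
  (∀ μ' : Fin K → ℝ, lagrangian A B d α u z μ' ≤ lagrangian A B d α u z μ) ∧
    ∀ (u' : Fin N → ℝ) (z' : Fin K → ℝ), lagrangian A B d α u z μ ≤ lagrangian A B d α u' z' μ

/-- Soft thresholding `(y / |y|) max (|y| - γ, 0)`, componentwise (the value is `0` where
`y i = 0`). -/
def shrink {n : ℕ} (y : Fin n → ℝ) (γ : ℝ) : Fin n → ℝ :=
  fun i => y i / |y i| * max (|y i| - γ) 0

/-- The stacked operator `F = [√α A; √λ B]`. -/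
def stackOp {M N K : ℕ} (A : Matrix (Fin M) (Fin N) ℝ) (B : Matrix (Fin K) (Fin N) ℝ)
    (α lam : ℝ) : Matrix (Fin M ⊕ Fin K) (Fin N) ℝ :=
  Matrix.fromRows (√α • A) (√lam • B)

/-- The stacked right-hand side `v = [√α d; √λ (z + b)]`. -/
def stackRhs {M K : ℕ} (d : Fin M → ℝ) (α lam : ℝ) (z b : Fin K → ℝ) : Fin M ⊕ Fin K → ℝ :=
  Sum.elim (√α • d) (√lam • (z + b))

/-- The contents of the memory of the Compressive Conjugate Directions method. After `k` passes
through the main loop the stored directions are `p i`, `q i` and the numbers `δ i` for `i ≤ k`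
(the remaining entries are unused). -/
structure State (M N K : ℕ) where
  u : Fin N → ℝ
  z : Fin K → ℝ
  b : Fin K → ℝ
  v : Fin M ⊕ Fin K → ℝ
  p : ℕ → Fin N → ℝ
  q : ℕ → Fin M ⊕ Fin K → ℝ
  δ : ℕ → ℝ

/-- Store the direction `pn` and its image `qn` at position `j`, together with `δ = qnᵀ qn`;
if `qnᵀ qn = 0`, store `p = 0`, `q = 0`, `δ = 1` instead. -/
def State.store {M N K : ℕ} (s : State M N K) (j : ℕ) (pn : Fin N → ℝ)
    (qn : Fin M ⊕ Fin K → ℝ) : State M N K :=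
  { s with
    p := Function.update s.p j (if qn ⬝ᵥ qn = 0 then 0 else pn)
    q := Function.update s.q j (if qn ⬝ᵥ qn = 0 then 0 else qn)
    δ := Function.update s.δ j (if qn ⬝ᵥ qn = 0 then 1 else qn ⬝ᵥ qn) }

/-- Initialization: `u₀ = 0`, `z₀ = 0`, `b₀ = 0`, `v₀ = [√α d; √λ (z₀ + b₀)]`, `p₀ = Fᵀ v₀`,
`q₀ = F p₀`, `δ₀ = q₀ᵀ q₀`. -/
def ccdInit {M N K : ℕ} (A : Matrix (Fin M) (Fin N) ℝ) (B : Matrix (Fin K) (Fin N) ℝ)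
    (d : Fin M → ℝ) (α lam : ℝ) : State M N K :=
  let F := stackOp A B α lam
  let v₀ := stackRhs d α lam (0 : Fin K → ℝ) 0
  let p₀ := Fᵀ *ᵥ v₀
  State.store { u := 0, z := 0, b := 0, v := v₀, p := 0, q := 0, δ := 0 } 0 p₀ (F *ᵥ p₀)

/-- Pass number `k` through the main loop. -/
def ccdStep {M N K : ℕ} (A : Matrix (Fin M) (Fin N) ℝ) (B : Matrix (Fin K) (Fin N) ℝ)
    (d : Fin M → ℝ) (α lam : ℝ) (k : ℕ) (s : State M N K) : State M N K :=
  let F := stackOp A B α lam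
  let τ : ℕ → ℝ := fun i => (s.q i ⬝ᵥ s.v) / s.δ i
  let u' := ∑ i ∈ Finset.range (k + 1), τ i • s.p i
  let z' := shrink (B *ᵥ u' - s.b) (1 / lam)
  let b' := s.b + z' - B *ᵥ u'
  let v' := stackRhs d α lam z' b'
  let r := v' - ∑ i ∈ Finset.range (k + 1), τ i • s.q i
  let w := Fᵀ *ᵥ r
  let t := F *ᵥ w
  let β : ℕ → ℝ := fun i => -(s.q i ⬝ᵥ t) / s.δ i
  let p' := ∑ i ∈ Finset.range (k + 1), β i • s.p i + w
  let q' := ∑ i ∈ Finset.range (k + 1), β i • s.q i + t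
  State.store { s with u := u', z := z', b := b', v := v' } (k + 1) p' q'

/-- The unlimited-memory Compressive Conjugate Directions method, run without a stopping test:
`ccd A B d α lam k` is the memory after `k` passes through the main loop, so that its fields
`u`, `z`, `b` are the iterates `u_k`, `z_k`, `b_k` and its field `p` holds `p_0, …, p_k`. -/
def ccd {M N K : ℕ} (A : Matrix (Fin M) (Fin N) ℝ) (B : Matrix (Fin K) (Fin N) ℝ)
    (d : Fin M → ℝ) (α lam : ℝ) : ℕ → State M N K
  | 0 => ccdInit A B d α lam
  | k + 1 => ccdStep A B d α lam k (ccd A B d α lam k)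

/-- The span of the directions `p_0, …, p_k` available to the method at iteration `k`. -/
def searchSpace {M N K : ℕ} (A : Matrix (Fin M) (Fin N) ℝ) (B : Matrix (Fin K) (Fin N) ℝ)
    (d : Fin M → ℝ) (α lam : ℝ) (k : ℕ) : Submodule ℝ (Fin N → ℝ) :=
  Submodule.span ℝ ((ccd A B d α lam k).p '' {i | i ≤ k})

/-- The function of `u` minimized in an ADMM step,
`(λ/2) ‖z - B u + b‖₂² + (α/2) ‖A u - d‖₂²`. -/
def admmObjective {M N K : ℕ} (A : Matrix (Fin M) (Fin N) ℝ) (B : Matrix (Fin K) (Fin N) ℝ)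
    (d : Fin M → ℝ) (α lam : ℝ) (z b : Fin K → ℝ) (u : Fin N → ℝ) : ℝ :=
  lam / 2 * sqNorm (z - B *ᵥ u + b) + α / 2 * sqNorm (A *ᵥ u - d)

/-- `(u', z', b')` is obtained from `(z, b)` by one ADMM step in which the minimization in `u` is
exact over the subspace `S`: `u'` is the unique minimizer over `S`,
`z' = shrink (B u' - b, 1/λ)` and `b' = b + z' - B u'`. With `S = ⊤` this is the exact ADMM step. -/
def IsADMMStepOn {M N K : ℕ} (A : Matrix (Fin M) (Fin N) ℝ) (B : Matrix (Fin K) (Fin N) ℝ)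
    (d : Fin M → ℝ) (α lam : ℝ) (S : Submodule ℝ (Fin N → ℝ)) (z b : Fin K → ℝ)
    (u' : Fin N → ℝ) (z' b' : Fin K → ℝ) : Prop :=
  (u' ∈ S ∧ ∀ x ∈ S, x ≠ u' →
      admmObjective A B d α lam z b u' < admmObjective A B d α lam z b x) ∧
    z' = shrink (B *ᵥ u' - b) (1 / lam) ∧ b' = b + z' - B *ᵥ u'

end CCD

end

/-! The search spaces grow with `k`, so in finite dimension they are eventually a fixed `S`. The
images `q i` are orthogonal, so the coefficients `τ i` solve the least-squares problem for `F u ≈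
v_k` over the span of the stored directions (`ccd_stationary`). From some iteration on the method is
therefore ADMM on `S`.

ADMM on any subspace converges to a saddle point over that subspace
(`IsADMMSequenceOn.exists_tendsto`): the squared distance of `(z, b)` to a saddle pair decreases,
and its decrements control `z_k - B u_{k+1}` and `A (u_{k+1} - u*)`.

The limit is optimal on the whole space even if `S` is proper. Each new direction is the residual
gradient `Fᵀ (v_k - F u_k)` plus old directions, so these gradients stay in `S`. Their limit lies in
`S` and, by stationarity on `S`, is orthogonal to `S`; hence it vanishes
(`isSaddleOn_top_of_tendsto`). Surjectivity of `B` makes the multiplier unique. If `S` is invariant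
under `Fᵀ F`, the same argument applies to `Fᵀ (v_k - F u_{k+1})` at each step, so the step is
exact. -/

namespace CCD

variable {M N K : ℕ}

/-! ### Linear algebra preliminaries -/

lemma mulVec_injective_of_rank {A : Matrix (Fin M) (Fin N) ℝ} (hA : A.rank = N) :
    Function.Injective (A *ᵥ ·) := by
  have h := LinearMap.finrank_range_add_finrank_ker A.mulVecLin
  have h' : Module.finrank ℝ (LinearMap.range A.mulVecLin) = N := hA
  rw [h', Module.finrank_fin_fun] at h
  have h0 : Module.finrank ℝ (LinearMap.ker A.mulVecLin) = 0 := by omega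
  exact LinearMap.ker_eq_bot.1 (Submodule.finrank_eq_zero.1 h0)

lemma mulVec_surjective_of_rank {B : Matrix (Fin K) (Fin N) ℝ} (hB : B.rank = K) :
    Function.Surjective (B *ᵥ ·) := by
  have h' : Module.finrank ℝ (LinearMap.range B.mulVecLin) = K := hB
  have h : LinearMap.range B.mulVecLin = ⊤ := by
    apply Submodule.eq_top_of_finrank_eq
    rw [h', Module.finrank_fin_fun]
  exact LinearMap.range_eq_top.1 h

lemma sqNorm_eq_dotProduct {n : ℕ} (x : Fin n → ℝ) : sqNorm x = x ⬝ᵥ x := by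
  simp [sqNorm, dotProduct, sq]

lemma dotProduct_self_pos {n : ℕ} {x : Fin n → ℝ} (hx : x ≠ 0) : 0 < x ⬝ᵥ x := by
  have h0 : 0 ≤ x ⬝ᵥ x := Finset.sum_nonneg fun _ _ => mul_self_nonneg _
  exact lt_of_le_of_ne h0 fun h => hx (dotProduct_self_eq_zero.1 h.symm)

lemma dotProduct_self_nonneg {n : ℕ} (x : Fin n → ℝ) : 0 ≤ x ⬝ᵥ x :=
  Finset.sum_nonneg fun _ _ => mul_self_nonneg _

lemma add_dotProduct_self {n : ℕ} (x y : Fin n → ℝ) :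
    (x + y) ⬝ᵥ (x + y) = x ⬝ᵥ x + 2 * (x ⬝ᵥ y) + y ⬝ᵥ y := by
  rw [add_dotProduct, dotProduct_add, dotProduct_add, dotProduct_comm y x]
  ring

lemma tendsto_zero_of_dotProduct_self {n : ℕ} {x : ℕ → Fin n → ℝ}
    (h : Tendsto (fun k => x k ⬝ᵥ x k) atTop (𝓝 0)) : Tendsto x atTop (𝓝 0) := by
  rw [tendsto_pi_nhds]
  intro i
  have hsq : Tendsto (fun k => x k i ^ 2) atTop (𝓝 0) := by
    refine squeeze_zero (fun k => sq_nonneg _) (fun k => ?_) h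
    have := Finset.single_le_sum (f := fun i => x k i * x k i)
      (fun _ _ => mul_self_nonneg _) (Finset.mem_univ i)
    simpa [sq, dotProduct] using this
  have h2 := hsq.sqrt
  simp only [Real.sqrt_sq_eq_abs, Real.sqrt_zero] at h2
  exact (tendsto_zero_iff_abs_tendsto_zero _).2 h2

lemma tendsto_of_mulVec_sub_tendsto_zero {A : Matrix (Fin M) (Fin N) ℝ}
    (hA : Function.Injective (A *ᵥ ·)) {x : ℕ → Fin N → ℝ} {y : Fin N → ℝ}
    (h : Tendsto (fun k => A *ᵥ (x k - y)) atTop (𝓝 0)) : Tendsto x atTop (𝓝 y) := by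
  obtain ⟨g, hg⟩ := A.mulVecLin.exists_leftInverse_of_injective (LinearMap.ker_eq_bot.2 hA)
  have hc : Continuous g := g.continuous_of_finiteDimensional
  have h1 := (hc.tendsto 0).comp h
  have h2 : (g ∘ fun k => A *ᵥ (x k - y)) = fun k => x k - y := by
    funext k
    exact LinearMap.congr_fun hg (x k - y)
  rw [h2, map_zero] at h1
  simpa using h1.add_const y

/-! ### Subgradients of the `ℓ¹` norm -/

/-- `c` is a subgradient of the `ℓ¹` norm at `z`. -/
def IsL1Subgradient {n : ℕ} (c z : Fin n → ℝ) : Prop :=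
  ∀ i, |c i| ≤ 1 ∧ c i * z i = |z i|

lemma mul_le_abs_of_abs_le_one {a b : ℝ} (h : |a| ≤ 1) : a * b ≤ |b| := by
  calc a * b ≤ |a * b| := le_abs_self _
    _ = |a| * |b| := abs_mul _ _
    _ ≤ |b| := mul_le_of_le_one_left (abs_nonneg b) h

lemma IsL1Subgradient.dotProduct_self {n : ℕ} {c z : Fin n → ℝ} (h : IsL1Subgradient c z) :
    c ⬝ᵥ z = l1Norm z :=
  Finset.sum_congr rfl fun i _ => (h i).2

lemma IsL1Subgradient.dotProduct_le {n : ℕ} {c z : Fin n → ℝ} (h : IsL1Subgradient c z)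
    (y : Fin n → ℝ) : c ⬝ᵥ y ≤ l1Norm y :=
  Finset.sum_le_sum fun i _ => mul_le_abs_of_abs_le_one (h i).1

lemma IsL1Subgradient.monotone {n : ℕ} {c z c' z' : Fin n → ℝ} (h : IsL1Subgradient c z)
    (h' : IsL1Subgradient c' z') : 0 ≤ (c - c') ⬝ᵥ (z - z') := by
  rw [sub_dotProduct, dotProduct_sub, dotProduct_sub, h.dotProduct_self, h'.dotProduct_self]
  linarith [h.dotProduct_le z', h'.dotProduct_le z]

lemma IsL1Subgradient.of_tendsto {n : ℕ} {c z : ℕ → Fin n → ℝ} {c' z' : Fin n → ℝ}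
    (h : ∀ k, IsL1Subgradient (c k) (z k)) (hc : Tendsto c atTop (𝓝 c'))
    (hz : Tendsto z atTop (𝓝 z')) : IsL1Subgradient c' z' := by
  intro i
  have hci := (tendsto_pi_nhds.1 hc) i
  have hzi := (tendsto_pi_nhds.1 hz) i
  refine ⟨le_of_tendsto' hci.abs fun k => (h k i).1, ?_⟩
  exact tendsto_nhds_unique ((hci.mul hzi).congr fun k => (h k i).2) hzi.abs

/-- Soft thresholding is the proximal map of the `ℓ¹` norm. For `y = B u' - b` the vector on the
left is `-λ b'`, which is how every iterate `b` carries a subgradient at `z`. -/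
lemma isL1Subgradient_shrink {n : ℕ} {lam : ℝ} (hlam : 0 < lam) (y : Fin n → ℝ) :
    IsL1Subgradient (lam • (y - shrink y (1 / lam))) (shrink y (1 / lam)) := by
  intro i
  simp only [Pi.smul_apply, Pi.sub_apply, shrink, smul_eq_mul]
  have hl : 0 < 1 / lam := by positivity
  have hll : lam * (1 / lam) = 1 := by field_simp
  generalize 1 / lam = γ at *
  rcases le_or_gt |y i| γ with h | h
  -- The second factor vanishes here, so the value of `y i / |y i|` at `y i = 0` is irrelevant.
  · rw [max_eq_right (by linarith)]
    simp only [mul_zero, sub_zero, abs_zero, and_true]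
    rw [abs_mul, abs_of_pos hlam, ← hll]
    gcongr
  · rw [max_eq_left (by linarith)]
    rcases lt_trichotomy (y i) 0 with h0 | h0 | h0
    · rw [abs_of_neg h0] at h ⊢
      have e : y i / -y i = -1 := by rw [div_neg, div_self h0.ne]
      rw [e]
      have e1 : lam * (y i - -1 * (-y i - γ)) = -1 := by linarith
      rw [e1, abs_of_nonpos (by linarith : -1 * (-y i - γ) ≤ 0)]
      norm_num
    · simp [h0] at h
      linarith
    · rw [abs_of_pos h0] at h ⊢
      have e : y i / y i = 1 := by field_simp
      rw [e]
      have e1 : lam * (y i - 1 * (y i - γ)) = 1 := by linarith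
      rw [e1, abs_of_nonneg (by linarith : 0 ≤ 1 * (y i - γ))]
      norm_num

/-! ### Saddle points over a subspace -/

/-- Optimality conditions for minimizing `‖B u‖₁ + (α/2) ‖A u - d‖₂²` over `u ∈ S`, with the
subgradient `c` of the `ℓ¹` norm at `B u`; the corresponding multiplier is `-c`. -/
structure IsSaddleOn (A : Matrix (Fin M) (Fin N) ℝ) (B : Matrix (Fin K) (Fin N) ℝ)
    (d : Fin M → ℝ) (α : ℝ) (S : Submodule ℝ (Fin N → ℝ)) (u : Fin N → ℝ) (c : Fin K → ℝ) :
    Prop where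
  mem : u ∈ S
  subgradient : IsL1Subgradient c (B *ᵥ u)
  stationary : ∀ h ∈ S, α * ((A *ᵥ u - d) ⬝ᵥ (A *ᵥ h)) + c ⬝ᵥ (B *ᵥ h) = 0

/-- Since `A` is injective, `(x, h) ↦ A x · A h` is an inner product on `S`; `R` is its Riesz map.
-/
lemma exists_riesz_on {A : Matrix (Fin M) (Fin N) ℝ} (hA : Function.Injective (A *ᵥ ·))
    (S : Submodule ℝ (Fin N → ℝ)) :
    ∃ R : (Fin N → ℝ) →ₗ[ℝ] S, ∀ r, ∀ h ∈ S,
      (A *ᵥ (R r : Fin N → ℝ)) ⬝ᵥ (A *ᵥ h) = r ⬝ᵥ h := by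
  let P : (Fin N → ℝ) →ₗ[ℝ] Module.Dual ℝ S :=
    (dotProductBilin ℝ ℝ).compr₂ LinearMap.id |>.compl₂ S.subtype
  let Φ : S →ₗ[ℝ] Module.Dual ℝ S :=
    P ∘ₗ (Aᵀ * A).mulVecLin ∘ₗ S.subtype
  have hP : ∀ r (h : S), P r h = r ⬝ᵥ (h : Fin N → ℝ) := fun r h => rfl
  have hΦ : ∀ x h : S, Φ x h = (A *ᵥ (x : Fin N → ℝ)) ⬝ᵥ (A *ᵥ (h : Fin N → ℝ)) := by
    intro x h
    change P ((Aᵀ * A) *ᵥ (x : Fin N → ℝ)) h = _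
    rw [hP, ← mulVec_mulVec, mulVec_transpose, ← dotProduct_mulVec]
  have hinj : Function.Injective Φ := by
    rw [← LinearMap.ker_eq_bot, LinearMap.ker_eq_bot']
    intro x hx
    have h1 := hΦ x x
    rw [hx, LinearMap.zero_apply] at h1
    have h2 := dotProduct_self_eq_zero.1 h1.symm
    exact Subtype.ext (hA (by simpa using h2))
  let e := LinearEquiv.ofInjectiveOfFinrankEq Φ hinj (Subspace.dual_finrank_eq).symm
  refine ⟨e.symm.toLinearMap ∘ₗ P, fun r h hh => ?_⟩
  rw [← hΦ _ ⟨h, hh⟩]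
  have h1 : Φ (e.symm (P r)) = P r := e.apply_symm_apply (P r)
  exact (LinearMap.congr_fun h1 ⟨h, hh⟩).trans (hP r ⟨h, hh⟩)

/-- First-order condition at a minimum: divide by `t` and let `t` decrease to `0`. The bound `t ≤ 1`
keeps segments inside a convex set. -/
lemma linear_coeff_nonneg_of_quadratic {a b : ℝ}
    (h : ∀ t : ℝ, 0 < t → t ≤ 1 → 0 ≤ t * a + t ^ 2 * b) : 0 ≤ a := by
  have hl : Tendsto (fun t : ℝ => a + t * b) (𝓝[>] 0) (𝓝 a) := by
    have : Continuous fun t : ℝ => a + t * b := by fun_prop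
    simpa using (this.tendsto 0).mono_left nhdsWithin_le_nhds
  refine ge_of_tendsto hl ?_
  filter_upwards [Ioc_mem_nhdsGT (zero_lt_one : (0 : ℝ) < 1)] with t ht
  have h1 := h t ht.1 ht.2
  have h2 : t * a + t ^ 2 * b = t * (a + t * b) := by ring
  rw [h2] at h1
  exact nonneg_of_mul_nonneg_right h1 ht.1

/-- Duality: `U c` minimizes `(α/2) ‖A u - d‖² + c · B u` over `S`, and the minimum value is a
constant minus `(α/2) ‖A U c‖²`. The dual problem thus minimizes `‖A U c‖²` over the compact box `|c
i| ≤ 1`, and its variational inequality says that `c` is a subgradient at `B (U c)`. -/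
lemma exists_isSaddleOn {A : Matrix (Fin M) (Fin N) ℝ} (hA : Function.Injective (A *ᵥ ·))
    (B : Matrix (Fin K) (Fin N) ℝ) (d : Fin M → ℝ) {α : ℝ} (hα : 0 < α)
    (S : Submodule ℝ (Fin N → ℝ)) : ∃ u c, IsSaddleOn A B d α S u c := by
  obtain ⟨R, hR⟩ := exists_riesz_on hA S
  let U : (Fin K → ℝ) → Fin N → ℝ := fun c => R (d ᵥ* A - α⁻¹ • (c ᵥ* B))
  have hU : ∀ c, U c ∈ S := fun c => (R _).2
  have hstat : ∀ c, ∀ h ∈ S, α * ((A *ᵥ U c) ⬝ᵥ (A *ᵥ h)) =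
      α * (d ⬝ᵥ (A *ᵥ h)) - c ⬝ᵥ (B *ᵥ h) := by
    intro c h hh
    rw [hR _ h hh, sub_dotProduct, smul_dotProduct, ← dotProduct_mulVec, ← dotProduct_mulVec,
      smul_eq_mul]
    field_simp
  have hcont : Continuous U := by
    have h1 : Continuous R := R.continuous_of_finiteDimensional
    have h2 : Continuous fun c : Fin K → ℝ => d ᵥ* A - α⁻¹ • (c ᵥ* B) := by fun_prop
    exact continuous_subtype_val.comp (h1.comp h2)
  have hne : (Set.Icc (-1 : Fin K → ℝ) 1).Nonempty :=
    ⟨0, fun i => by simp, fun i => by simp⟩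
  obtain ⟨c, hc, hmin⟩ := isCompact_Icc.exists_isMinOn hne
    (f := fun c => (A *ᵥ U c) ⬝ᵥ (A *ᵥ U c)) (by fun_prop)
  have hvar : ∀ c' ∈ Set.Icc (-1 : Fin K → ℝ) 1, c' ⬝ᵥ (B *ᵥ U c) ≤ c ⬝ᵥ (B *ᵥ U c) := by
    intro c' hc'
    have hlin : ∀ t : ℝ, U (c + t • (c' - c)) = U c + t • (U c' - U c) := by
      intro t
      simp only [U, ← Submodule.coe_sub, ← Submodule.coe_smul, ← Submodule.coe_add, ← map_sub,
        ← map_smul, ← map_add]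
      congr 2
      simp only [add_vecMul, smul_vecMul, sub_vecMul]
      module
    have hkey : 0 ≤ 2 * ((A *ᵥ U c) ⬝ᵥ (A *ᵥ (U c' - U c))) := by
      refine linear_coeff_nonneg_of_quadratic
        (b := (A *ᵥ (U c' - U c)) ⬝ᵥ (A *ᵥ (U c' - U c))) fun t ht0 ht1 => ?_
      have hmem : c + t • (c' - c) ∈ Set.Icc (-1 : Fin K → ℝ) 1 :=
        (convex_Icc _ _).add_smul_sub_mem hc hc' ⟨ht0.le, ht1⟩
      have h1 : (A *ᵥ U c) ⬝ᵥ (A *ᵥ U c) ≤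
          (A *ᵥ U (c + t • (c' - c))) ⬝ᵥ (A *ᵥ U (c + t • (c' - c))) := hmin hmem
      rw [hlin, mulVec_add, mulVec_smul, add_dotProduct_self, dotProduct_smul, smul_dotProduct,
        dotProduct_smul] at h1
      simp only [smul_eq_mul] at h1
      linarith
    have e1 := hstat c' (U c) (hU c)
    have e2 := hstat c (U c) (hU c)
    rw [mulVec_sub, dotProduct_sub, dotProduct_comm (A *ᵥ U c) (A *ᵥ U c')] at hkey
    have := mul_nonneg hα.le hkey
    linarith
  refine ⟨U c, c, hU c, fun i => ?_, fun h hh => ?_⟩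
  · have hci : |c i| ≤ 1 := abs_le.2 ⟨hc.1 i, hc.2 i⟩
    have hs : ∀ s : ℝ, |s| ≤ 1 → s * (B *ᵥ U c) i ≤ c i * (B *ᵥ U c) i := by
      intro s hs
      -- Moving a single coordinate within the box decouples the variational inequality; `s = 1` and
      -- `s = -1` then give the absolute value.
      have hmem : Function.update c i s ∈ Set.Icc (-1 : Fin K → ℝ) 1 := by
        constructor <;> intro j <;> by_cases hj : j = i
        · subst hj; simpa using (abs_le.1 hs).1
        · simpa [hj] using hc.1 j
        · subst hj; simpa using (abs_le.1 hs).2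
        · simpa [hj] using hc.2 j
      have h1 := hvar _ hmem
      have h2 : Function.update c i s = c + Pi.single i (s - c i) := by
        funext j
        by_cases hj : j = i
        · subst hj; simp
        · simp [hj]
      rw [h2, add_dotProduct, single_dotProduct] at h1
      linarith
    refine ⟨hci, le_antisymm (mul_le_abs_of_abs_le_one hci) (abs_le'.2 ⟨?_, ?_⟩)⟩
    · simpa using hs 1 (by simp)
    · simpa using hs (-1) (by simp)
  · rw [sub_dotProduct, mul_sub, hstat c h hh]
    ring

/-! ### Convergence of ADMM over a subspace -/

/-- For errors relative to a saddle point and `y = B (u' - u*)`, the vector `eb + ez' - y` is the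
new error of `b`. -/
lemma admm_energy_identity {n : ℕ} (ez eb ez' y : Fin n → ℝ) :
    ez' ⬝ᵥ ez' + (eb + ez' - y) ⬝ᵥ (eb + ez' - y) + (ez - y) ⬝ᵥ (ez - y)
        + 2 * ((ez + eb - y) ⬝ᵥ y) =
      ez ⬝ᵥ ez + eb ⬝ᵥ eb + 2 * ((eb + ez' - y) ⬝ᵥ ez') := by
  simp only [dotProduct, Finset.mul_sum, ← Finset.sum_add_distrib]
  refine Finset.sum_congr rfl fun i _ => ?_
  simp only [Pi.add_apply, Pi.sub_apply]
  ring

/-- The iterates `(u k, z k, b k)` are produced by ADMM with exact minimization over `S`, starting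
from some `(z 0, b 0)` with `-λ (b 0)` a subgradient at `z 0`. -/
structure IsADMMSequenceOn (A : Matrix (Fin M) (Fin N) ℝ) (B : Matrix (Fin K) (Fin N) ℝ)
    (d : Fin M → ℝ) (α lam : ℝ) (S : Submodule ℝ (Fin N → ℝ)) (u : ℕ → Fin N → ℝ)
    (z b : ℕ → Fin K → ℝ) : Prop where
  mem : ∀ k, u (k + 1) ∈ S
  subgradient : ∀ k, IsL1Subgradient (-(lam • b k)) (z k)
  stationary : ∀ k, ∀ h ∈ S, α * ((A *ᵥ u (k + 1) - d) ⬝ᵥ (A *ᵥ h)) =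
    lam * ((z k + b k - B *ᵥ u (k + 1)) ⬝ᵥ (B *ᵥ h))
  update : ∀ k, b (k + 1) = b k + z (k + 1) - B *ᵥ u (k + 1)

section

variable {A : Matrix (Fin M) (Fin N) ℝ} {B : Matrix (Fin K) (Fin N) ℝ} {d : Fin M → ℝ}
  {α lam : ℝ} {S : Submodule ℝ (Fin N → ℝ)} {u : ℕ → Fin N → ℝ} {z b : ℕ → Fin K → ℝ}

/-- The squared distance of `(z, b)` to `(zs, bs)`. -/
def energy (zs bs z b : Fin K → ℝ) : ℝ :=
  (z - zs) ⬝ᵥ (z - zs) + (b - bs) ⬝ᵥ (b - bs)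

lemma energy_nonneg (zs bs z b : Fin K → ℝ) : 0 ≤ energy zs bs z b :=
  add_nonneg (dotProduct_self_nonneg _) (dotProduct_self_nonneg _)

/-- In `admm_energy_identity` the last inner product is nonpositive by monotonicity of the
subdifferential, and the one with `y` equals `(α/λ) ‖A (u_{k+1} - u*)‖²` by subtracting the two
stationarity conditions. -/
lemma IsADMMSequenceOn.energy_succ_le (h : IsADMMSequenceOn A B d α lam S u z b)
    (hlam : 0 < lam) {us : Fin N → ℝ} {bs : Fin K → ℝ}
    (hs : IsSaddleOn A B d α S us (-(lam • bs))) (k : ℕ) :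
    energy (B *ᵥ us) bs (z (k + 1)) (b (k + 1)) +
      (z k - B *ᵥ u (k + 1)) ⬝ᵥ (z k - B *ᵥ u (k + 1)) +
      2 * (α / lam) * ((A *ᵥ (u (k + 1) - us)) ⬝ᵥ (A *ᵥ (u (k + 1) - us))) ≤
    energy (B *ᵥ us) bs (z k) (b k) := by
  have hmem : u (k + 1) - us ∈ S := S.sub_mem (h.mem k) hs.mem
  have h1 := h.stationary k _ hmem
  have h2 := hs.stationary _ hmem
  have hid := admm_energy_identity (z k - B *ᵥ us) (b k - bs) (z (k + 1) - B *ᵥ us)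
    (B *ᵥ (u (k + 1) - us))
  have e1 : b k - bs + (z (k + 1) - B *ᵥ us) - B *ᵥ (u (k + 1) - us) = b (k + 1) - bs := by
    rw [h.update, mulVec_sub]; abel
  have e2 : z k - B *ᵥ us - B *ᵥ (u (k + 1) - us) = z k - B *ᵥ u (k + 1) := by
    rw [mulVec_sub]; abel
  have e3 : z k - B *ᵥ us + (b k - bs) - B *ᵥ (u (k + 1) - us) =
      (z k + b k - B *ᵥ u (k + 1)) - bs := by
    rw [mulVec_sub]; abel
  rw [e1, e2, e3] at hid
  have hmono := (h.subgradient (k + 1)).monotone hs.subgradient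
  have e4 : -(lam • b (k + 1)) - -(lam • bs) = -(lam • (b (k + 1) - bs)) := by
    rw [smul_sub]; abel
  rw [e4, neg_dotProduct, smul_dotProduct, smul_eq_mul] at hmono
  have hm : (b (k + 1) - bs) ⬝ᵥ (z (k + 1) - B *ᵥ us) ≤ 0 := by
    by_contra hcon
    have := mul_pos hlam (not_le.1 hcon)
    linarith
  have e5 : (A *ᵥ (u (k + 1) - us)) ⬝ᵥ (A *ᵥ (u (k + 1) - us)) =
      (A *ᵥ u (k + 1) - d) ⬝ᵥ (A *ᵥ (u (k + 1) - us)) -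
        (A *ᵥ us - d) ⬝ᵥ (A *ᵥ (u (k + 1) - us)) := by
    rw [← sub_dotProduct]
    congr 1
    rw [mulVec_sub]; abel
  rw [neg_dotProduct, smul_dotProduct, smul_eq_mul] at h2
  have e6 : α / lam * ((A *ᵥ (u (k + 1) - us)) ⬝ᵥ (A *ᵥ (u (k + 1) - us))) =
      (z k + b k - B *ᵥ u (k + 1) - bs) ⬝ᵥ (B *ᵥ (u (k + 1) - us)) := by
    rw [e5, sub_dotProduct _ bs, div_mul_eq_mul_div, div_eq_iff hlam.ne']
    linarith
  unfold energy
  linarith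

lemma IsADMMSequenceOn.antitone_energy (h : IsADMMSequenceOn A B d α lam S u z b)
    (hα : 0 < α) (hlam : 0 < lam) {us : Fin N → ℝ} {bs : Fin K → ℝ}
    (hs : IsSaddleOn A B d α S us (-(lam • bs))) :
    Antitone fun k => energy (B *ᵥ us) bs (z k) (b k) := by
  refine antitone_nat_of_succ_le fun k => ?_
  have h1 := h.energy_succ_le hlam hs k
  have h2 := dotProduct_self_nonneg (z k - B *ᵥ u (k + 1))
  have h3 := mul_nonneg (by positivity : 0 ≤ 2 * (α / lam))
    (dotProduct_self_nonneg (A *ᵥ (u (k + 1) - us)))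
  linarith

/-- Multipliers over `S` need not be unique, since `B` restricted to `S` need not be onto. So an
arbitrary saddle point yields the limits of `u` and `z`, while the limit of `b` is found by
compactness. -/
lemma IsADMMSequenceOn.exists_tendsto (h : IsADMMSequenceOn A B d α lam S u z b)
    (hA : Function.Injective (A *ᵥ ·)) (hα : 0 < α) (hlam : 0 < lam) :
    ∃ us bs, IsSaddleOn A B d α S us (-(lam • bs)) ∧ Tendsto u atTop (𝓝 us) ∧
      Tendsto z atTop (𝓝 (B *ᵥ us)) ∧ Tendsto b atTop (𝓝 bs) := by
  obtain ⟨us, c, hs⟩ := exists_isSaddleOn hA B d hα S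
  obtain ⟨b₀, rfl⟩ : ∃ b₀, c = -(lam • b₀) :=
    ⟨-(lam⁻¹ • c), by rw [smul_neg, smul_smul, mul_inv_cancel₀ hlam.ne', one_smul, neg_neg]⟩
  have hanti := h.antitone_energy hα hlam hs
  have hbdd : BddBelow (Set.range fun k => energy (B *ᵥ us) b₀ (z k) (b k)) :=
    ⟨0, by rintro _ ⟨k, rfl⟩; exact energy_nonneg _ _ _ _⟩
  have hlim := tendsto_atTop_ciInf hanti hbdd
  have hdiff := hlim.sub (hlim.comp (tendsto_add_atTop_nat 1))
  rw [sub_self] at hdiff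
  have hc : 0 < 2 * (α / lam) := by positivity
  have hres : Tendsto (fun k => z k - B *ᵥ u (k + 1)) atTop (𝓝 0) := by
    refine tendsto_zero_of_dotProduct_self
      (squeeze_zero (fun _ => dotProduct_self_nonneg _) (fun k => ?_) hdiff)
    have h1 := h.energy_succ_le hlam hs k
    have h3 := mul_nonneg hc.le (dotProduct_self_nonneg (A *ᵥ (u (k + 1) - us)))
    simp only [Function.comp_apply]
    linarith
  have hu1 : Tendsto (fun k => u (k + 1)) atTop (𝓝 us) := by
    refine tendsto_of_mulVec_sub_tendsto_zero hA (tendsto_zero_of_dotProduct_self ?_)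
    have hdiff' := hdiff.const_mul (2 * (α / lam))⁻¹
    rw [mul_zero] at hdiff'
    refine squeeze_zero (fun _ => dotProduct_self_nonneg _) (fun k => ?_) hdiff'
    have h1 := h.energy_succ_le hlam hs k
    have h2 := dotProduct_self_nonneg (z k - B *ᵥ u (k + 1))
    rw [← div_eq_inv_mul, le_div_iff₀ hc]
    simp only [Function.comp_apply]
    linarith
  have hu : Tendsto u atTop (𝓝 us) := (tendsto_add_atTop_iff_nat 1).1 hu1
  have hBu : Tendsto (fun k => B *ᵥ u (k + 1)) atTop (𝓝 (B *ᵥ us)) :=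
    ((by fun_prop : Continuous fun x => B *ᵥ x).tendsto us).comp hu1
  have hz : Tendsto z atTop (𝓝 (B *ᵥ us)) := by
    simpa using hres.add hBu
  have hbox : ∀ k, b k ∈ Set.Icc (fun _ : Fin K => -(1 / lam)) (fun _ => 1 / lam) := by
    have hb : ∀ k i, |b k i| ≤ 1 / lam := by
      intro k i
      have := (h.subgradient k i).1
      rw [Pi.neg_apply, abs_neg, Pi.smul_apply, smul_eq_mul, abs_mul, abs_of_pos hlam] at this
      rwa [le_div_iff₀' hlam]
    exact fun k => ⟨fun i => (abs_le.1 (hb k i)).1, fun i => (abs_le.1 (hb k i)).2⟩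
  -- A cluster point `bs` of `b` is again a multiplier over `S`. The energy relative to it is
  -- antitone and tends to `0` along `φ`, hence along the whole sequence.
  obtain ⟨bs, -, φ, hφ, hbφ⟩ := isCompact_Icc.tendsto_subseq hbox
  have hφt := hφ.tendsto_atTop
  have hs' : IsSaddleOn A B d α S us (-(lam • bs)) := by
    refine ⟨hs.mem, IsL1Subgradient.of_tendsto (fun k => h.subgradient (φ k))
      ((hbφ.const_smul lam).neg) (hz.comp hφt), fun x hx => ?_⟩
    have hl : Tendsto (fun k => α * ((A *ᵥ u (φ k + 1) - d) ⬝ᵥ (A *ᵥ x))) atTop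
        (𝓝 (α * ((A *ᵥ us - d) ⬝ᵥ (A *ᵥ x)))) :=
      ((by fun_prop : Continuous fun y => α * ((A *ᵥ y - d) ⬝ᵥ (A *ᵥ x))).tendsto us).comp
        (hu1.comp hφt)
    have hw : Tendsto (fun k => z (φ k) + b (φ k) - B *ᵥ u (φ k + 1)) atTop (𝓝 bs) := by
      simpa using ((hz.comp hφt).add hbφ).sub (hBu.comp hφt)
    have hr : Tendsto (fun k => lam * ((z (φ k) + b (φ k) - B *ᵥ u (φ k + 1)) ⬝ᵥ (B *ᵥ x))) atTop
        (𝓝 (lam * (bs ⬝ᵥ (B *ᵥ x)))) :=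
      ((by fun_prop : Continuous fun y => lam * (y ⬝ᵥ (B *ᵥ x))).tendsto bs).comp hw
    have := tendsto_nhds_unique (hl.congr fun k => h.stationary (φ k) x hx) hr
    rw [this, neg_dotProduct, smul_dotProduct, smul_eq_mul]
    ring
  refine ⟨us, bs, hs', hu, hz, ?_⟩
  have hanti' := h.antitone_energy hα hlam hs'
  have hcont : Continuous fun y : (Fin K → ℝ) × (Fin K → ℝ) => energy (B *ᵥ us) bs y.1 y.2 := by
    unfold energy; fun_prop
  have hsub : Tendsto ((fun k => energy (B *ᵥ us) bs (z k) (b k)) ∘ φ) atTop (𝓝 0) := by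
    have h1 := (hcont.tendsto (B *ᵥ us, bs)).comp ((hz.comp hφt).prodMk_nhds hbφ)
    simpa [energy, Function.comp_def] using h1
  have hall := (tendsto_iff_tendsto_subseq_of_antitone hanti' hφt).2 hsub
  have hb0 : Tendsto (fun k => b k - bs) atTop (𝓝 0) := by
    refine tendsto_zero_of_dotProduct_self
      (squeeze_zero (fun _ => dotProduct_self_nonneg _) (fun k => ?_) hall)
    exact le_add_of_nonneg_left (dotProduct_self_nonneg _)
  simpa using hb0.add_const bs

end

/-! ### Saddle points over the whole space -/

section

variable {A : Matrix (Fin M) (Fin N) ℝ} {B : Matrix (Fin K) (Fin N) ℝ} {d : Fin M → ℝ}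
  {α lam : ℝ} {us : Fin N → ℝ} {μ : Fin K → ℝ}

lemma sqNorm_mulVec_add_sub (A : Matrix (Fin M) (Fin N) ℝ) (d : Fin M → ℝ)
    (u h : Fin N → ℝ) :
    sqNorm (A *ᵥ (u + h) - d) = sqNorm (A *ᵥ u - d) + 2 * ((A *ᵥ u - d) ⬝ᵥ (A *ᵥ h)) +
      (A *ᵥ h) ⬝ᵥ (A *ᵥ h) := by
  have e : A *ᵥ (u + h) - d = (A *ᵥ u - d) + A *ᵥ h := by
    rw [mulVec_add]; abel
  rw [e, sqNorm_eq_dotProduct, sqNorm_eq_dotProduct, add_dotProduct_self]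

/-- Stationarity cancels the linear term of the quadratic, and `‖z‖₁ + μ · z` is nonnegative, with
value `0` at `B us`. The quadratic gap gives uniqueness of the solution. -/
lemma IsSaddleOn.lagrangian_add_le (hs : IsSaddleOn A B d α ⊤ us (-μ)) (u : Fin N → ℝ)
    (z : Fin K → ℝ) :
    lagrangian A B d α us (B *ᵥ us) μ + α / 2 * ((A *ᵥ (u - us)) ⬝ᵥ (A *ᵥ (u - us))) ≤
      lagrangian A B d α u z μ := by
  obtain ⟨h, rfl⟩ : ∃ h, u = us + h := ⟨u - us, by abel⟩
  have h1 := hs.subgradient.dotProduct_self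
  have h2 := hs.subgradient.dotProduct_le z
  have h3 := hs.stationary h trivial
  rw [neg_dotProduct] at h1 h2 h3
  rw [add_sub_cancel_left]
  simp only [lagrangian, objective, sqNorm_mulVec_add_sub, sub_self, dotProduct_zero]
  rw [dotProduct_sub, mulVec_add B, dotProduct_add μ]
  linarith

lemma IsSaddleOn.isSolution (hα : 0 < α) (hs : IsSaddleOn A B d α ⊤ us (-μ)) :
    IsSolution A B d α us (B *ᵥ us) := by
  refine ⟨rfl, ?_⟩
  rintro u _ rfl
  have h1 := hs.lagrangian_add_le u (B *ᵥ u)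
  have h2 := mul_nonneg hα.le (dotProduct_self_nonneg (A *ᵥ (u - us)))
  simp only [lagrangian, sub_self, dotProduct_zero] at h1
  linarith

lemma IsSaddleOn.eq_of_isSolution (hA : Function.Injective (A *ᵥ ·)) (hα : 0 < α)
    (hs : IsSaddleOn A B d α ⊤ us (-μ)) {u : Fin N → ℝ} {z : Fin K → ℝ}
    (h : IsSolution A B d α u z) : u = us ∧ z = B *ᵥ us := by
  obtain ⟨rfl, hmin⟩ := h
  have h1 := hs.lagrangian_add_le u (B *ᵥ u)
  have h2 := hmin us _ rfl
  simp only [lagrangian, sub_self, dotProduct_zero] at h1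
  have h3 : (A *ᵥ (u - us)) ⬝ᵥ (A *ᵥ (u - us)) = 0 := by
    refine le_antisymm ?_ (dotProduct_self_nonneg _)
    by_contra hcon
    have := mul_pos hα (not_le.1 hcon)
    linarith
  have h4 : u - us = 0 := hA (by simpa using dotProduct_self_eq_zero.1 h3)
  have h5 := sub_eq_zero.1 h4
  exact ⟨h5, by rw [h5]⟩

lemma IsSaddleOn.isLagrangeMultiplier (hα : 0 < α) (hs : IsSaddleOn A B d α ⊤ us (-μ)) :
    IsLagrangeMultiplier A B d α us (B *ᵥ us) μ := by
  refine ⟨fun μ' => by simp [lagrangian], fun u z => ?_⟩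
  have h1 := hs.lagrangian_add_le u z
  have h2 := mul_nonneg hα.le (dotProduct_self_nonneg (A *ᵥ (u - us)))
  linarith

lemma IsLagrangeMultiplier.stationary {u : Fin N → ℝ} {z : Fin K → ℝ}
    (hμ : IsLagrangeMultiplier A B d α u z μ) (h : Fin N → ℝ) :
    μ ⬝ᵥ (B *ᵥ h) = α * ((A *ᵥ u - d) ⬝ᵥ (A *ᵥ h)) := by
  have hle : ∀ h, μ ⬝ᵥ (B *ᵥ h) ≤ α * ((A *ᵥ u - d) ⬝ᵥ (A *ᵥ h)) := by
    intro h
    rw [← sub_nonneg]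
    refine linear_coeff_nonneg_of_quadratic
      (b := α / 2 * ((A *ᵥ h) ⬝ᵥ (A *ᵥ h))) fun t _ _ => ?_
    have h1 := hμ.2 (u + t • h) z
    simp only [lagrangian, objective, sqNorm_mulVec_add_sub] at h1
    simp only [dotProduct_sub μ, mulVec_add, mulVec_smul, dotProduct_add, dotProduct_smul,
      smul_dotProduct, smul_eq_mul] at h1
    linarith
  refine le_antisymm (hle h) ?_
  have := hle (-h)
  simp only [mulVec_neg, dotProduct_neg] at this
  linarith

/-- Stationarity in `u` determines `Bᵀ μ`, and `Bᵀ` is injective when `B` is onto. -/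
lemma IsLagrangeMultiplier.unique (hB : Function.Surjective (B *ᵥ ·)) {u : Fin N → ℝ}
    {z μ' : Fin K → ℝ} (h : IsLagrangeMultiplier A B d α u z μ)
    (h' : IsLagrangeMultiplier A B d α u z μ') : μ = μ' := by
  obtain ⟨x, hx⟩ := hB (μ - μ')
  have e := (h.stationary x).trans (h'.stationary x).symm
  rw [← sub_eq_zero, ← sub_dotProduct] at e
  simp only at hx
  rw [hx] at e
  exact sub_eq_zero.1 (dotProduct_self_eq_zero.1 e)

end

/-! ### The ADMM step as a least-squares problem -/

lemma stackOp_mulVec (A : Matrix (Fin M) (Fin N) ℝ) (B : Matrix (Fin K) (Fin N) ℝ) (α lam : ℝ)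
    (x : Fin N → ℝ) : stackOp A B α lam *ᵥ x = Sum.elim (√α • (A *ᵥ x)) (√lam • (B *ᵥ x)) := by
  rw [stackOp, fromRows_mulVec, smul_mulVec, smul_mulVec]

lemma stackOp_injective {A : Matrix (Fin M) (Fin N) ℝ} (hA : Function.Injective (A *ᵥ ·))
    (B : Matrix (Fin K) (Fin N) ℝ) {α : ℝ} (hα : 0 < α) (lam : ℝ) :
    Function.Injective (stackOp A B α lam *ᵥ ·) := by
  intro x y hxy
  simp only [stackOp_mulVec] at hxy
  have h1 : √α • (A *ᵥ x) = √α • (A *ᵥ y) := by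
    funext i
    exact congrFun hxy (Sum.inl i)
  exact hA (smul_right_injective _ (Real.sqrt_pos.2 hα).ne' h1)

/-- Links the normal equations for `F` with ADMM: the right side is minus the derivative of
`admmObjective` at `u` along `h`. -/
lemma stackRhs_sub_dotProduct (A : Matrix (Fin M) (Fin N) ℝ) (B : Matrix (Fin K) (Fin N) ℝ)
    (d : Fin M → ℝ) {α lam : ℝ} (hα : 0 < α) (hlam : 0 < lam) (z b : Fin K → ℝ)
    (u h : Fin N → ℝ) :
    (stackRhs d α lam z b - stackOp A B α lam *ᵥ u) ⬝ᵥ (stackOp A B α lam *ᵥ h) =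
      lam * ((z + b - B *ᵥ u) ⬝ᵥ (B *ᵥ h)) - α * ((A *ᵥ u - d) ⬝ᵥ (A *ᵥ h)) := by
  have hα' := Real.mul_self_sqrt hα.le
  have hl' := Real.mul_self_sqrt hlam.le
  simp only [stackOp_mulVec, stackRhs, sub_dotProduct, sumElim_dotProduct_sumElim,
    smul_dotProduct, dotProduct_smul, smul_eq_mul]
  linear_combination (d ⬝ᵥ (A *ᵥ h) - (A *ᵥ u) ⬝ᵥ (A *ᵥ h)) * hα' +
    ((z + b) ⬝ᵥ (B *ᵥ h) - (B *ᵥ u) ⬝ᵥ (B *ᵥ h)) * hl'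

/-- Stationarity is needed only along `x - u`, so this serves both `S` and the whole space. -/
lemma admmObjective_lt {A : Matrix (Fin M) (Fin N) ℝ} (hA : Function.Injective (A *ᵥ ·))
    (B : Matrix (Fin K) (Fin N) ℝ) (d : Fin M → ℝ) {α lam : ℝ} (hα : 0 < α) (hlam : 0 < lam)
    (z b : Fin K → ℝ) {u x : Fin N → ℝ} (hne : x ≠ u)
    (hopt : α * ((A *ᵥ u - d) ⬝ᵥ (A *ᵥ (x - u))) =
      lam * ((z + b - B *ᵥ u) ⬝ᵥ (B *ᵥ (x - u)))) :
    admmObjective A B d α lam z b u < admmObjective A B d α lam z b x := by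
  obtain ⟨h, rfl⟩ : ∃ h, x = u + h := ⟨x - u, by abel⟩
  rw [add_sub_cancel_left] at hopt
  have hh : A *ᵥ h ≠ 0 := fun h0 => hne (by
    rw [hA (by simpa using h0 : A *ᵥ h = A *ᵥ 0), add_zero])
  have h1 := mul_pos hα (dotProduct_self_pos hh)
  have h2 := mul_nonneg hlam.le (dotProduct_self_nonneg (B *ᵥ h))
  have e1 : z - B *ᵥ u + b = z + b - B *ᵥ u := by abel
  have e2 : z - B *ᵥ (u + h) + b = (z + b - B *ᵥ u) + -(B *ᵥ h) := by
    rw [mulVec_add]; abel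
  simp only [admmObjective, sqNorm_mulVec_add_sub]
  rw [e1, e2, sqNorm_eq_dotProduct (_ + -(B *ᵥ h)), add_dotProduct_self,
    sqNorm_eq_dotProduct (_ - B *ᵥ u)]
  simp only [dotProduct_neg, neg_dotProduct, neg_neg]
  linarith

/-! ### Conjugate directions -/

/-- The directions `p 0, …, p k` are conjugate with respect to `Fᵀ F`, with images `q i` and
squared norms `δ i` (`δ i` is arbitrary nonzero if `q i = 0`). -/
structure IsConjugate (F : Matrix (Fin M ⊕ Fin K) (Fin N) ℝ) (k : ℕ) (p : ℕ → Fin N → ℝ)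
    (q : ℕ → Fin M ⊕ Fin K → ℝ) (δ : ℕ → ℝ) : Prop where
  image : ∀ i ≤ k, q i = F *ᵥ p i
  ne_zero : ∀ i ≤ k, δ i ≠ 0
  norm : ∀ i ≤ k, q i ⬝ᵥ q i = δ i ∨ q i = 0
  orthogonal : ∀ i ≤ k, ∀ j ≤ k, i ≠ j → q i ⬝ᵥ q j = 0

section

variable {F : Matrix (Fin M ⊕ Fin K) (Fin N) ℝ} {k : ℕ} {p : ℕ → Fin N → ℝ}
  {q : ℕ → Fin M ⊕ Fin K → ℝ} {δ : ℕ → ℝ}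

/-- The sum is the orthogonal projection of `x` onto the span of the `q i`. A reset direction `q j =
0` gives `0` on both sides, whatever `δ j` is. -/
lemma IsConjugate.dotProduct_sum (h : IsConjugate F k p q δ) (x : Fin M ⊕ Fin K → ℝ) {j : ℕ}
    (hj : j ≤ k) :
    q j ⬝ᵥ ∑ i ∈ Finset.range (k + 1), (q i ⬝ᵥ x / δ i) • q i = q j ⬝ᵥ x := by
  rw [_root_.dotProduct_sum, Finset.sum_eq_single j]
  · rw [dotProduct_smul, smul_eq_mul]
    rcases h.norm j hj with h1 | h1
    · rw [h1, div_mul_cancel₀ _ (h.ne_zero j hj)]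
    · simp [h1]
  · intro i hi hij
    rw [dotProduct_smul, h.orthogonal j hj i (by simp at hi; omega) (Ne.symm hij), smul_zero]
  · intro hj'
    simp at hj'
    omega

lemma IsConjugate.mulVec_sum (h : IsConjugate F k p q δ) (c : ℕ → ℝ) :
    F *ᵥ ∑ i ∈ Finset.range (k + 1), c i • p i = ∑ i ∈ Finset.range (k + 1), c i • q i := by
  rw [Matrix.mulVec_sum]
  refine Finset.sum_congr rfl fun i hi => ?_
  rw [mulVec_smul, h.image i (by simp at hi; omega)]

lemma sum_smul_mem_span (c : ℕ → ℝ) (k : ℕ) (p : ℕ → Fin N → ℝ) :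
    ∑ i ∈ Finset.range (k + 1), c i • p i ∈ Submodule.span ℝ (p '' {i | i ≤ k}) :=
  Submodule.sum_mem _ fun i hi => Submodule.smul_mem _ _
    (Submodule.subset_span ⟨i, by simp at hi ⊢; omega, rfl⟩)

lemma IsConjugate.dotProduct_mulVec_eq_zero (h : IsConjugate F k p q δ)
    (x : Fin M ⊕ Fin K → ℝ) {y : Fin N → ℝ}
    (hy : y ∈ Submodule.span ℝ (p '' {i | i ≤ k})) :
    (x - F *ᵥ ∑ i ∈ Finset.range (k + 1), (q i ⬝ᵥ x / δ i) • p i) ⬝ᵥ (F *ᵥ y) = 0 := by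
  rw [h.mulVec_sum]
  induction hy using Submodule.span_induction with
  | mem y hy =>
    obtain ⟨j, hj, rfl⟩ := hy
    rw [← h.image j hj, dotProduct_comm, dotProduct_sub, h.dotProduct_sum x hj, sub_self]
  | zero => simp
  | add y z _ _ hy hz => rw [mulVec_add, dotProduct_add, hy, hz, add_zero]
  | smul a y _ hy => rw [mulVec_smul, dotProduct_smul, hy, smul_zero]

/-- The reset never alters a direction: as `F` is injective, a zero image forces a zero direction.
-/
lemma ite_dotProduct_self_eq (hF : Function.Injective (F *ᵥ ·)) (x : Fin N → ℝ) :
    (if (F *ᵥ x) ⬝ᵥ (F *ᵥ x) = 0 then 0 else x) = x := by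
  split_ifs with h
  · exact (hF (by simpa using dotProduct_self_eq_zero.1 h)).symm
  · rfl

lemma ite_dotProduct_self_eq_self (y : Fin M ⊕ Fin K → ℝ) :
    (if y ⬝ᵥ y = 0 then 0 else y) = y := by
  split_ifs with h
  · exact (dotProduct_self_eq_zero.1 h).symm
  · rfl

lemma IsConjugate.update (hF : Function.Injective (F *ᵥ ·)) {j : ℕ} {x : Fin N → ℝ}
    (h : ∀ i < j, q i = F *ᵥ p i ∧ δ i ≠ 0 ∧ (q i ⬝ᵥ q i = δ i ∨ q i = 0))
    (ho : ∀ i < j, ∀ l < j, i ≠ l → q i ⬝ᵥ q l = 0)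
    (hx : ∀ i < j, q i ⬝ᵥ (F *ᵥ x) = 0) :
    IsConjugate F j
      (Function.update p j (if (F *ᵥ x) ⬝ᵥ (F *ᵥ x) = 0 then 0 else x))
      (Function.update q j (if (F *ᵥ x) ⬝ᵥ (F *ᵥ x) = 0 then 0 else F *ᵥ x))
      (Function.update δ j (if (F *ᵥ x) ⬝ᵥ (F *ᵥ x) = 0 then 1 else (F *ᵥ x) ⬝ᵥ (F *ᵥ x))) := by
  rw [ite_dotProduct_self_eq hF, ite_dotProduct_self_eq_self]
  have hlt : ∀ i ≤ j, i ≠ j → i < j := fun i hi hij => lt_of_le_of_ne hi hij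
  refine ⟨fun i hi => ?_, fun i hi => ?_, fun i hi => ?_, fun i hi l hl hil => ?_⟩
  · rcases eq_or_ne i j with rfl | hij
    · simp
    · simpa [hij] using (h i (hlt i hi hij)).1
  · rcases eq_or_ne i j with rfl | hij
    · rw [Function.update_self]
      split_ifs with h0
      · exact one_ne_zero
      · exact h0
    · simpa [hij] using (h i (hlt i hi hij)).2.1
  · rcases eq_or_ne i j with rfl | hij
    · rw [Function.update_self, Function.update_self]
      split_ifs with h0
      · exact Or.inr (dotProduct_self_eq_zero.1 h0)
      · exact Or.inl rfl
    · simpa [hij] using (h i (hlt i hi hij)).2.2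
  · rcases eq_or_ne i j with rfl | hij
    · rw [Function.update_self, Function.update_of_ne hil.symm, dotProduct_comm]
      exact hx l (hlt l hl hil.symm)
    · rw [Function.update_of_ne hij]
      rcases eq_or_ne l j with rfl | hlj
      · rw [Function.update_self]
        exact hx i (hlt i hi hij)
      · rw [Function.update_of_ne hlj]
        exact ho i (hlt i hi hij) l (hlt l hl hlj) hil

end

/-! ### The invariants of the method -/

section

variable {A : Matrix (Fin M) (Fin N) ℝ} (B : Matrix (Fin K) (Fin N) ℝ)
    (d : Fin M → ℝ) {α lam : ℝ}

/-- What holds for the memory after `k` passes through the main loop. -/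
structure Invariant (A : Matrix (Fin M) (Fin N) ℝ) (B : Matrix (Fin K) (Fin N) ℝ)
    (d : Fin M → ℝ) (α lam : ℝ) (k : ℕ) (s : State M N K) : Prop where
  conj : IsConjugate (stackOp A B α lam) k s.p s.q s.δ
  rhs : s.v = stackRhs d α lam s.z s.b
  subgradient : IsL1Subgradient (-(lam • s.b)) s.z
  mem : s.u ∈ Submodule.span ℝ (s.p '' {i | i ≤ k})
  residual_mem : (stackOp A B α lam)ᵀ *ᵥ (s.v - stackOp A B α lam *ᵥ s.u) ∈
    Submodule.span ℝ (s.p '' {i | i ≤ k})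

lemma invariant_ccdInit (hA : Function.Injective (A *ᵥ ·)) (hα : 0 < α) :
    Invariant A B d α lam 0 (ccdInit A B d α lam) := by
  have hF := stackOp_injective hA B hα lam
  have hp : (ccdInit A B d α lam).p 0 =
      (stackOp A B α lam)ᵀ *ᵥ stackRhs d α lam (0 : Fin K → ℝ) 0 := by
    simp only [ccdInit, State.store, Function.update_self]
    exact ite_dotProduct_self_eq hF _
  refine ⟨IsConjugate.update hF (by simp) (by simp) (by simp), rfl, fun i => ?_,
    Submodule.zero_mem _, ?_⟩
  · simp [ccdInit, State.store]
  -- With `u₀ = 0` the residual gradient is `Fᵀ v₀`, which is `p₀` itself.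
  · refine Submodule.subset_span ⟨0, by simp, hp.trans ?_⟩
    simp [ccdInit, State.store]

lemma ccdStep_z (k : ℕ) (s : State M N K) :
    (ccdStep A B d α lam k s).z =
      shrink (B *ᵥ (ccdStep A B d α lam k s).u - s.b) (1 / lam) := rfl

lemma ccdStep_b (k : ℕ) (s : State M N K) :
    (ccdStep A B d α lam k s).b =
      s.b + (ccdStep A B d α lam k s).z - B *ᵥ (ccdStep A B d α lam k s).u := rfl

lemma ccdStep_v (k : ℕ) (s : State M N K) :
    (ccdStep A B d α lam k s).v =
      stackRhs d α lam (ccdStep A B d α lam k s).z (ccdStep A B d α lam k s).b := rfl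

lemma ccdStep_p_of_le {k i : ℕ} (hi : i ≤ k) (s : State M N K) :
    (ccdStep A B d α lam k s).p i = s.p i :=
  Function.update_of_ne (by omega) _ _

lemma span_le_span_ccdStep (k : ℕ) (s : State M N K) :
    Submodule.span ℝ (s.p '' {i | i ≤ k}) ≤
      Submodule.span ℝ ((ccdStep A B d α lam k s).p '' {i | i ≤ k + 1}) := by
  refine Submodule.span_mono ?_
  rintro _ ⟨i, hi, rfl⟩
  exact ⟨i, Nat.le_succ_of_le hi, ccdStep_p_of_le B d hi s⟩

lemma Invariant.ccdStep {k : ℕ} {s : State M N K} (hs : Invariant A B d α lam k s)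
    (hA : Function.Injective (A *ᵥ ·)) (hα : 0 < α) (hlam : 0 < lam) :
    Invariant A B d α lam (k + 1) (ccdStep A B d α lam k s) := by
  have hF := stackOp_injective hA B hα lam
  set F := stackOp A B α lam
  set s' := CCD.ccdStep A B d α lam k s with hs'
  have hFu : F *ᵥ s'.u = ∑ i ∈ Finset.range (k + 1), (s.q i ⬝ᵥ s.v / s.δ i) • s.q i :=
    hs.conj.mulVec_sum _
  set w := Fᵀ *ᵥ (s'.v - F *ᵥ s'.u) with hw
  set β : ℕ → ℝ := fun i => -(s.q i ⬝ᵥ (F *ᵥ w)) / s.δ i with hβ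
  set x := ∑ i ∈ Finset.range (k + 1), β i • s.p i + w with hx
  have hFx : F *ᵥ x = ∑ i ∈ Finset.range (k + 1), β i • s.q i + F *ᵥ w := by
    rw [hx, mulVec_add, hs.conj.mulVec_sum]
  -- The method uses `∑ τ i • q i` and `∑ β i • q i + t`; conjugacy identifies these with `F u'` and
  -- `F x`.
  have hstore : s' = State.store { s with u := s'.u, z := s'.z, b := s'.b, v := s'.v }
      (k + 1) x (F *ᵥ x) := by
    rw [hFx, hx, hβ, hw, hFu]
    rfl
  have hpx : s'.p (k + 1) = x := by
    rw [hstore]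
    simp only [State.store, Function.update_self]
    exact ite_dotProduct_self_eq hF _
  have hmono := span_le_span_ccdStep (A := A) (α := α) (lam := lam) B d k s
  refine ⟨?_, ccdStep_v B d k s, ?_, hmono (sum_smul_mem_span _ _ _), ?_⟩
  · rw [hstore]
    refine IsConjugate.update hF (fun i hi => ?_) (fun i hi l hl => ?_) (fun i hi => ?_)
    · have hi' := Nat.le_of_lt_succ hi
      exact ⟨hs.conj.image i hi', hs.conj.ne_zero i hi', hs.conj.norm i hi'⟩
    · exact hs.conj.orthogonal i (Nat.le_of_lt_succ hi) l (Nat.le_of_lt_succ hl)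
    · have h1 := hs.conj.dotProduct_sum (F *ᵥ w) (Nat.le_of_lt_succ hi)
      have h2 : ∑ i ∈ Finset.range (k + 1), β i • s.q i =
          -∑ i ∈ Finset.range (k + 1), (s.q i ⬝ᵥ (F *ᵥ w) / s.δ i) • s.q i := by
        rw [← Finset.sum_neg_distrib]
        refine Finset.sum_congr rfl fun i _ => ?_
        simp only [hβ, neg_div, neg_smul]
      rw [hFx, dotProduct_add, h2, dotProduct_neg]
      exact neg_add_eq_zero.2 h1
  · have h1 := isL1Subgradient_shrink hlam (B *ᵥ s'.u - s.b)
    rw [← ccdStep_z B d k s] at h1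
    convert h1 using 1
    rw [ccdStep_b B d k s, ← hs', ← smul_neg]
    congr 1
    abel
  -- The new residual gradient `w` is the new direction minus a combination of old ones.
  · have h1 : w = x - ∑ i ∈ Finset.range (k + 1), β i • s.p i := by rw [hx]; abel
    rw [← hw, h1]
    exact Submodule.sub_mem _ (Submodule.subset_span ⟨k + 1, by simp, hpx⟩)
      (hmono (sum_smul_mem_span _ _ _))

lemma invariant_ccd (hA : Function.Injective (A *ᵥ ·)) (hα : 0 < α) (hlam : 0 < lam) (k : ℕ) :
    Invariant A B d α lam k (ccd A B d α lam k) := by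
  induction k with
  | zero => exact invariant_ccdInit B d hA hα
  | succ k ih => exact ih.ccdStep B d hA hα hlam

lemma monotone_searchSpace : Monotone (searchSpace A B d α lam) :=
  monotone_nat_of_le_succ fun k => span_le_span_ccdStep B d k (ccd A B d α lam k)

lemma exists_searchSpace_eq :
    ∃ k₁, ∀ k, k₁ ≤ k → searchSpace A B d α lam k = searchSpace A B d α lam k₁ := by
  obtain ⟨n, hn⟩ := monotone_stabilizes_iff_noetherian.2
    (inferInstance : IsNoetherian ℝ (Fin N → ℝ)) ⟨searchSpace A B d α lam, monotone_searchSpace B d⟩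
  exact ⟨n, fun k hk => (hn k hk).symm⟩

/-- The index is `k`, not `k + 1`: `p_{k+1}` is built only after `u_{k+1}`. -/
lemma ccd_u_succ_mem (k : ℕ) : (ccd A B d α lam (k + 1)).u ∈ searchSpace A B d α lam k :=
  sum_smul_mem_span _ _ _

lemma ccd_residual_orthogonal (hA : Function.Injective (A *ᵥ ·)) (hα : 0 < α) (hlam : 0 < lam)
    (k : ℕ) {h : Fin N → ℝ} (hh : h ∈ searchSpace A B d α lam k) :
    ((ccd A B d α lam k).v - stackOp A B α lam *ᵥ (ccd A B d α lam (k + 1)).u) ⬝ᵥ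
      (stackOp A B α lam *ᵥ h) = 0 :=
  (invariant_ccd B d hA hα hlam k).conj.dotProduct_mulVec_eq_zero _ hh

lemma ccd_stationary (hA : Function.Injective (A *ᵥ ·)) (hα : 0 < α) (hlam : 0 < lam)
    (k : ℕ) {h : Fin N → ℝ} (hh : h ∈ searchSpace A B d α lam k) :
    α * ((A *ᵥ (ccd A B d α lam (k + 1)).u - d) ⬝ᵥ (A *ᵥ h)) =
      lam * (((ccd A B d α lam k).z + (ccd A B d α lam k).b -
        B *ᵥ (ccd A B d α lam (k + 1)).u) ⬝ᵥ (B *ᵥ h)) := by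
  have h1 := ccd_residual_orthogonal B d hA hα hlam k hh
  rw [(invariant_ccd B d hA hα hlam k).rhs, stackRhs_sub_dotProduct A B d hα hlam] at h1
  linarith

/-- If the search space is invariant under `Fᵀ F`, the least-squares problem of the method is
solved exactly over the whole space. -/
lemma ccd_residual_eq_zero (hA : Function.Injective (A *ᵥ ·)) (hα : 0 < α) (hlam : 0 < lam)
    (k : ℕ) (hinv : ∀ x ∈ searchSpace A B d α lam k,
      ((stackOp A B α lam)ᵀ * stackOp A B α lam) *ᵥ x ∈ searchSpace A B d α lam k) :
    (stackOp A B α lam)ᵀ *ᵥ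
      ((ccd A B d α lam k).v - stackOp A B α lam *ᵥ (ccd A B d α lam (k + 1)).u) = 0 := by
  have hI := invariant_ccd B d hA hα hlam k
  set F := stackOp A B α lam
  set v := (ccd A B d α lam k).v
  set u := (ccd A B d α lam k).u
  set u' := (ccd A B d α lam (k + 1)).u
  -- The first summand is in the search space by `residual_mem`, the second by invariance.
  have e : Fᵀ *ᵥ (v - F *ᵥ u') = Fᵀ *ᵥ (v - F *ᵥ u) + (Fᵀ * F) *ᵥ (u - u') := by
    simp only [← mulVec_mulVec, mulVec_sub]
    abel
  have hmem : Fᵀ *ᵥ (v - F *ᵥ u') ∈ searchSpace A B d α lam k := by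
    rw [e]
    exact Submodule.add_mem _ hI.residual_mem
      (hinv _ (Submodule.sub_mem _ hI.mem (ccd_u_succ_mem B d k)))
  have h0 := ccd_residual_orthogonal B d hA hα hlam k hmem
  rw [dotProduct_mulVec, ← mulVec_transpose] at h0
  exact dotProduct_self_eq_zero.1 h0

lemma ccd_stationary_of_invariant (hA : Function.Injective (A *ᵥ ·)) (hα : 0 < α)
    (hlam : 0 < lam) (k : ℕ) (hinv : ∀ x ∈ searchSpace A B d α lam k,
      ((stackOp A B α lam)ᵀ * stackOp A B α lam) *ᵥ x ∈ searchSpace A B d α lam k)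
    (h : Fin N → ℝ) :
    α * ((A *ᵥ (ccd A B d α lam (k + 1)).u - d) ⬝ᵥ (A *ᵥ h)) =
      lam * (((ccd A B d α lam k).z + (ccd A B d α lam k).b -
        B *ᵥ (ccd A B d α lam (k + 1)).u) ⬝ᵥ (B *ᵥ h)) := by
  have h1 := stackRhs_sub_dotProduct A B d hα hlam (ccd A B d α lam k).z (ccd A B d α lam k).b
    (ccd A B d α lam (k + 1)).u h
  rw [← (invariant_ccd B d hA hα hlam k).rhs, dotProduct_mulVec, ← mulVec_transpose,
    ccd_residual_eq_zero B d hA hα hlam k hinv, zero_dotProduct] at h1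
  linarith

lemma isADMMSequenceOn_ccd (hA : Function.Injective (A *ᵥ ·)) (hα : 0 < α) (hlam : 0 < lam)
    {S : Submodule ℝ (Fin N → ℝ)} {k₁ : ℕ}
    (hS : ∀ k, k₁ ≤ k → searchSpace A B d α lam k = S) :
    IsADMMSequenceOn A B d α lam S (fun k => (ccd A B d α lam (k + k₁)).u)
      (fun k => (ccd A B d α lam (k + k₁)).z) (fun k => (ccd A B d α lam (k + k₁)).b) where
  mem k := by
    rw [← hS (k + k₁) (by omega), Nat.add_right_comm]
    exact ccd_u_succ_mem B d _
  subgradient k := (invariant_ccd B d hA hα hlam _).subgradient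
  stationary k h hh := by
    rw [Nat.add_right_comm]
    exact ccd_stationary B d hA hα hlam _ (by rwa [hS _ (by omega)])
  update k := by
    rw [Nat.add_right_comm]
    rfl

/-- The limit of the method is stationary over the whole space: the gradients `Fᵀ (v_k - F u_k)`
lie in the search space, while their limit is orthogonal to it. -/
lemma isSaddleOn_top_of_tendsto (hA : Function.Injective (A *ᵥ ·)) (hα : 0 < α)
    (hlam : 0 < lam) {S : Submodule ℝ (Fin N → ℝ)} {k₁ : ℕ}
    (hS : ∀ k, k₁ ≤ k → searchSpace A B d α lam k = S) {us : Fin N → ℝ} {bs : Fin K → ℝ}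
    (hs : IsSaddleOn A B d α S us (-(lam • bs)))
    (hu : Tendsto (fun k => (ccd A B d α lam k).u) atTop (𝓝 us))
    (hz : Tendsto (fun k => (ccd A B d α lam k).z) atTop (𝓝 (B *ᵥ us)))
    (hb : Tendsto (fun k => (ccd A B d α lam k).b) atTop (𝓝 bs)) :
    IsSaddleOn A B d α ⊤ us (-(lam • bs)) := by
  set F := stackOp A B α lam
  have hcont : Continuous fun y : (Fin N → ℝ) × (Fin K → ℝ) × (Fin K → ℝ) =>
      Fᵀ *ᵥ (stackRhs d α lam y.2.1 y.2.2 - F *ᵥ y.1) := by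
    have h1 : Continuous fun y : (Fin N → ℝ) × (Fin K → ℝ) × (Fin K → ℝ) =>
        stackRhs d α lam y.2.1 y.2.2 := by
      refine continuous_pi fun i => ?_
      rcases i with i | i <;> simp only [stackRhs, Sum.elim_inl, Sum.elim_inr] <;> fun_prop
    fun_prop
  have hlim := (hcont.tendsto (us, B *ᵥ us, bs)).comp
    (hu.prodMk_nhds (hz.prodMk_nhds hb))
  have hmem : Fᵀ *ᵥ (stackRhs d α lam (B *ᵥ us) bs - F *ᵥ us) ∈ S := by
    refine S.closed_of_finiteDimensional.mem_of_tendsto hlim ?_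
    filter_upwards [eventually_ge_atTop k₁] with k hk
    have hI := invariant_ccd (A := A) B d hA hα hlam k
    have h1 := hI.residual_mem
    rw [hI.rhs] at h1
    rw [← hS k hk]
    exact h1
  have hortho : ∀ h : Fin N → ℝ, (Fᵀ *ᵥ (stackRhs d α lam (B *ᵥ us) bs - F *ᵥ us)) ⬝ᵥ h =
      -(α * ((A *ᵥ us - d) ⬝ᵥ (A *ᵥ h)) + (-(lam • bs)) ⬝ᵥ (B *ᵥ h)) := by
    intro h
    rw [mulVec_transpose, ← dotProduct_mulVec, stackRhs_sub_dotProduct A B d hα hlam,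
      add_sub_cancel_left, neg_dotProduct, smul_dotProduct, smul_eq_mul]
    ring
  -- Stationarity over `S` is tested in the direction of the gradient itself, which lies in `S`.
  have hzero : Fᵀ *ᵥ (stackRhs d α lam (B *ᵥ us) bs - F *ᵥ us) = 0 := by
    refine dotProduct_self_eq_zero.1 ((hortho _).trans ?_)
    rw [hs.stationary _ hmem, neg_zero]
  refine ⟨trivial, hs.subgradient, fun h _ => ?_⟩
  have h1 := hortho h
  rw [hzero, zero_dotProduct] at h1
  linarith

end

end CCD

theorem theorem3p3 {M N K : ℕ} (A : Matrix (Fin M) (Fin N) ℝ) (B : Matrix (Fin K) (Fin N) ℝ)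
    (d : Fin M → ℝ) (α lam : ℝ) (hα : 0 < α) (hlam : 0 < lam)
    (hNM : N ≤ M) (hKN : K ≤ N) (hA : A.rank = N) (hB : B.rank = K) :
    ∃ (ustar : Fin N → ℝ) (zstar μstar : Fin K → ℝ),
      -- `(ustar, zstar)` is the unique solution, `μstar` its unique vector of multipliers
      (CCD.IsSolution A B d α ustar zstar ∧
        ∀ (u : Fin N → ℝ) (z : Fin K → ℝ), CCD.IsSolution A B d α u z → u = ustar ∧ z = zstar) ∧
      (CCD.IsLagrangeMultiplier A B d α ustar zstar μstar ∧
        ∀ μ : Fin K → ℝ, CCD.IsLagrangeMultiplier A B d α ustar zstar μ → μ = μstar) ∧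
      -- convergence of the iterates
      Tendsto (fun k => (CCD.ccd A B d α lam k).u) atTop (𝓝 ustar) ∧
      Tendsto (fun k => (CCD.ccd A B d α lam k).z) atTop (𝓝 zstar) ∧
      Tendsto (fun k => (CCD.ccd A B d α lam k).b) atTop (𝓝 (lam⁻¹ • μstar)) ∧
      -- from a finite iteration on, the method is ADMM on a fixed subspace `S`, and it is
      -- the exact ADMM if `S` is invariant under `Fᵀ F` (in particular if `S` is everything)
      ∃ (S : Submodule ℝ (Fin N → ℝ)) (k₁ : ℕ),
        (∀ k, k₁ ≤ k → CCD.searchSpace A B d α lam k = S) ∧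
        (∀ k, k₁ ≤ k →
          CCD.IsADMMStepOn A B d α lam S (CCD.ccd A B d α lam k).z (CCD.ccd A B d α lam k).b
            (CCD.ccd A B d α lam (k + 1)).u (CCD.ccd A B d α lam (k + 1)).z
            (CCD.ccd A B d α lam (k + 1)).b) ∧
        ((∀ x ∈ S, ((CCD.stackOp A B α lam)ᵀ * CCD.stackOp A B α lam) *ᵥ x ∈ S) →
          ∀ k, k₁ ≤ k →
            CCD.IsADMMStepOn A B d α lam ⊤ (CCD.ccd A B d α lam k).z (CCD.ccd A B d α lam k).b
              (CCD.ccd A B d α lam (k + 1)).u (CCD.ccd A B d α lam (k + 1)).z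
              (CCD.ccd A B d α lam (k + 1)).b) := by
  have hAi := CCD.mulVec_injective_of_rank hA
  have hBs := CCD.mulVec_surjective_of_rank hB
  obtain ⟨k₁, hk₁⟩ := CCD.exists_searchSpace_eq (A := A) (α := α) (lam := lam) B d
  set S := CCD.searchSpace A B d α lam k₁
  obtain ⟨us, bs, hs, hu, hz, hb⟩ :=
    (CCD.isADMMSequenceOn_ccd B d hAi hα hlam hk₁).exists_tendsto hAi hα hlam
  -- The ADMM sequence starts at iteration `k₁`; dropping the shift does not change limits.
  replace hu := (tendsto_add_atTop_iff_nat (f := fun k => (CCD.ccd A B d α lam k).u) k₁).1 hu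
  replace hz := (tendsto_add_atTop_iff_nat (f := fun k => (CCD.ccd A B d α lam k).z) k₁).1 hz
  replace hb := (tendsto_add_atTop_iff_nat (f := fun k => (CCD.ccd A B d α lam k).b) k₁).1 hb
  have hs' := CCD.isSaddleOn_top_of_tendsto B d hAi hα hlam hk₁ hs hu hz hb
  have hμ := hs'.isLagrangeMultiplier hα
  refine ⟨us, B *ᵥ us, lam • bs, ⟨hs'.isSolution hα, fun u z h => hs'.eq_of_isSolution hAi hα h⟩,
    ⟨hμ, fun μ h => h.unique hBs hμ⟩, hu, hz, ?_, S, k₁, hk₁, fun k hk => ⟨⟨?_, fun x hx hne => ?_⟩,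
      rfl, rfl⟩, fun hinv k hk => ⟨⟨trivial, fun x _ hne => ?_⟩, rfl, rfl⟩⟩
  · rwa [smul_smul, inv_mul_cancel₀ hlam.ne', one_smul]
  · rw [← hk₁ k hk]
    exact CCD.ccd_u_succ_mem B d k
  · refine CCD.admmObjective_lt hAi B d hα hlam _ _ hne
      (CCD.ccd_stationary B d hAi hα hlam k ?_)
    rw [hk₁ k hk]
    refine S.sub_mem hx ?_
    rw [← hk₁ k hk]
    exact CCD.ccd_u_succ_mem B d k
  · exact CCD.admmObjective_lt hAi B d hα hlam _ _ hne
      (CCD.ccd_stationary_of_invariant B d hAi hα hlam k (by rwa [hk₁ k hk]) _)
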